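/- Let $q$ be a prime power, $n\ge 1$, and let $C\subseteq\mathbb F_{q^2}^n$ be an $\mathbb F_{q^2}$-linear code of dimension $k$. Let $C^{\perp_{\rm H}}=\{b\in\mathbb F_{q^2}^n : \sum_i c_i b_i^q=0 \text{ for all } c\in C\}$ be its Hermitian dual and put $e:=k-\dim_{\mathbb F_{q^2}}(C\cap C^{\perp_{\rm H}})$. For $S\subseteq\mathbb F_{q^2}^n$ let $\operatorname{wgt}(S)$ be the minimum Hamming weight of a nonzero vector of $S$ and $d(S)$ the minimum Hamming distance between two distinct vectors of $S$; a minimum over the empty set is taken to be $n$. Then $n-2k+e\ge 0$, and there exists an $[[n+e,\,n-2k+e,\,d(\mathcal Q)]]_q$ quantum stabilizer code $\mathcal Q$, that is, a nonzero joint $+1$-eigenspace $\mathcal Q\subseteq(\mathbb C^q)^{\otimes(n+e)}$ of an abelian group of unitary error operators $c\,X(a)Z(b)$ ($c\in\mathbb C$, $a,b\in\mathbb F_q^{n+e}$), with $\dim_{\mathbb C}\mathcal Q=q^{\,n-2k+e}$, such that: 1. $d(\mathcal Q)\ge\min\{d(C^{\perp_{\rm H}}),\,d(C+C^{\perp_{\rm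 H}})+1\}$; 2. if $n-2k+e>0$ (equivalently, $C^{\perp_{\rm H}}\not\subseteq C$), then moreover $$\min\bigl\{\operatorname{wgt}\bigl(C^{\perp_{\rm H}}\setminus(C\cap C^{\perp_{\rm H}})\bigr),\ \operatorname{wgt}\bigl((C+C^{\perp_{\rm H}})\setminus C\bigr)+1\bigr\}\ \le\ d(\mathcal Q)\ \le\ \operatorname{wgt}\bigl(C^{\perp_{\rm H}}\setminus(C\cap C^{\perp_{\rm H}})\bigr).$$ The lower bound in 2 is always at least the lower bound in 1: $$\min\bigl\{\operatorname{wgt}\bigl(C^{\perp_{\rm H}}\setminus(C\cap C^{\perp_{\rm H}})\bigr),\ \operatorname{wgt}\bigl((C+C^{\perp_{\rm H}})\setminus C\bigr)+1\bigr\}\ \ge\ \min\{d(C^{\perp_{\rm H}}),\,d(C+C^{\perp_{\rm H}})+1\}.$$ Here $X(a)Z(b)|y\rangle=\exp\bigl(2\pi i\operatorname{tr}(b\cdot y)/p\bigr)|y+a\rangle$ for $y\in\mathbb F_q^{n+e}$, where $p$ is the characteristic of $\mathbb F_q$ and $\operatorname{tr}$ is the trace from $\mathbb F_q$ to $\mathbb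 F_p$. The minimum distance $d(\mathcal Q)$ is the largest $d$ such that every linear operator $E$ acting on at most $d-1$ of the tensor factors satisfies $PEP=\lambda_E P$ for some scalar $\lambda_E$, with $P$ the orthogonal projection onto $\mathcal Q$; if $\dim\mathcal Q=1$, it is required in addition, as usual, that $\lambda_E=\operatorname{tr}(E)/q^{\,n+e}$ (so that $d(\mathcal Q)$ is then the least weight of a nonidentity element of the stabilizer). -/

import Mathlib

open scoped Matrix

noncomputable section

/-! ### Classical codes: minimum weight, minimum distance, Hermitian dual -/

section Classical

variable {K : Type*} [Field K] [DecidableEq K] {n : ℕ}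

open Classical in
/-- `wgt(S)`: the minimum Hamming weight of a nonzero vector of `S`, and `n` if `S` has no
nonzero vector. -/
def minWeight (S : Set (Fin n → K)) : ℕ :=
  if (S \ {0}).Nonempty then sInf {w | ∃ x ∈ S \ {0}, w = hammingNorm x} else n

open Classical in
/-- `d(S)`: the minimum Hamming distance between two distinct vectors of `S`, and `n` if there
are no two distinct vectors in `S`. -/
def minDist (S : Set (Fin n → K)) : ℕ :=
  if S.Nontrivial then sInf {w | ∃ x ∈ S, ∃ y ∈ S, x ≠ y ∧ w = hammingDist x y} else n

end Classical

section Hermitian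

variable (F : Type*) [Field F] [Fintype F] {K : Type*} [Field K] [Algebra F K] {n : ℕ}

/-- The Hermitian inner product `∑ i, u i * (v i) ^ q`, where `q = |F|`. -/
def hermInner (u v : Fin n → K) : K := ∑ i, u i * v i ^ Fintype.card F

/-- The Hermitian dual `{b | ∀ c ∈ C, ⟨c, b⟩_H = 0}`. -/
def hermDual (C : Submodule K (Fin n → K)) : Submodule K (Fin n → K) where
  carrier := {b | ∀ c ∈ C, hermInner F c b = 0}
  zero_mem' := by
    intro c _
    simp [hermInner]
  add_mem' := by
    intro a b ha hb c hc
    have hadd : ∀ x y : K, (x + y) ^ Fintype.card F = x ^ Fintype.card F + y ^ Fintype.card F :=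
      fun x y => map_add (FiniteField.frobeniusAlgHom F K) x y
    have h1 := ha c hc
    have h2 := hb c hc
    simp only [hermInner] at h1 h2 ⊢
    simp only [Pi.add_apply, hadd, mul_add, Finset.sum_add_distrib, h1, h2, add_zero]
  smul_mem' := by
    intro r b hb c hc
    have h1 := hb c hc
    simp only [hermInner] at h1 ⊢
    have : ∀ i, c i * (r • b) i ^ Fintype.card F
        = r ^ Fintype.card F * (c i * b i ^ Fintype.card F) := by
      intro i
      simp only [Pi.smul_apply, smul_eq_mul, mul_pow]
      ring
    simp only [this, ← Finset.mul_sum, h1, mul_zero]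

end Hermitian

/-! ### Quantum stabilizer codes -/

section Quantum

variable {F : Type*} [Field F] [Fintype F] {N : ℕ}

/-- The state space `(ℂ^q)^{⊗ N}`, `q = |F|`, written in the orthonormal basis `|x⟩`,
`x ∈ F^N`, of products `|x_0⟩ ⊗ ⋯ ⊗ |x_{N-1}⟩`. -/
abbrev QuditSpace (F : Type*) (N : ℕ) : Type _ := (Fin N → F) → ℂ

/-- Operators on `(ℂ^q)^{⊗ N}`, as matrices in the basis `|x⟩`. -/
abbrev QuditOp (F : Type*) (N : ℕ) : Type _ := Matrix (Fin N → F) (Fin N → F) ℂ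

/-- The standard additive character `x ↦ exp(2πi tr(x) / p)` of `F`, where `p` is the
characteristic and `tr` the absolute trace. -/
def errChar (F : Type*) [Field F] [Fintype F] : AddChar F ℂ :=
  letI : Algebra (ZMod (ringChar F)) F := ZMod.algebra F (ringChar F)
  haveI : NeZero (ringChar F) := ⟨CharP.ringChar_ne_zero_of_finite F⟩
  (ZMod.stdAddChar (N := ringChar F)).compAddMonoidHom
    (Algebra.trace (ZMod (ringChar F)) F).toAddMonoidHom

variable [DecidableEq F]

/-- The error operator `X(a) Z(b) : |y⟩ ↦ exp(2πi tr(b · y) / p) |y + a⟩`. -/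
def errorOp (a b : Fin N → F) : QuditOp F N :=
  Matrix.of fun x y => if x = y + a then errChar F (b ⬝ᵥ y) else 0

/-- A stabilizer code is a nonzero joint `+1`-eigenspace of an abelian group of unitary error
operators, that is, of scalar multiples `c X(a) Z(b)`.  (As the eigenspace is nonzero, the phases
`c` that occur are roots of unity and the only scalar operator in the group is the identity.) -/
def IsStabilizerCode (Q : Submodule ℂ (QuditSpace F N)) : Prop :=
  Q ≠ ⊥ ∧ ∃ S : Subgroup (Matrix.unitaryGroup (Fin N → F) ℂ),
    (∀ g ∈ S, ∀ h ∈ S, g * h = h * g) ∧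
    (∀ g ∈ S, ∃ (c : ℂ) (a b : Fin N → F), (g : QuditOp F N) = c • errorOp a b) ∧
    (∀ v : QuditSpace F N, v ∈ Q ↔ ∀ g ∈ S, (g : QuditOp F N) *ᵥ v = v)

/-- The operator `E` acts only on the tensor factors in `T`: it is `A ⊗ 1`, with `A` an operator
on the factors in `T` and `1` the identity on the other factors. -/
def ActsOn (T : Finset (Fin N)) (E : QuditOp F N) : Prop :=
  ∃ A : Matrix (T → F) (T → F) ℂ, ∀ x y : Fin N → F,
    E x y = if ∀ i, i ∉ T → x i = y i then A (fun i => x i) (fun i => y i) else 0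

/-- The error `E` is detected by `Q` or has no effect on it: `P E P = c P` for some scalar `c`,
where `P` is the orthogonal projection onto `Q`. -/
def Detects (Q : Submodule ℂ (QuditSpace F N)) (E : QuditOp F N) : Prop :=
  ∃ c : ℂ, ∀ u ∈ Q, ∀ v ∈ Q, star u ⬝ᵥ (E *ᵥ v) = c * (star u ⬝ᵥ v)

/-- As `Detects`, with the scalar `c` equal to the normalized trace of `E`. -/
def DetectsPurely (Q : Submodule ℂ (QuditSpace F N)) (E : QuditOp F N) : Prop :=
  ∀ u ∈ Q, ∀ v ∈ Q,
    star u ⬝ᵥ (E *ᵥ v) = (E.trace / (Fintype.card F : ℂ) ^ N) * (star u ⬝ᵥ v)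

/-- The condition on a single error that enters the minimum distance.  Every error is trivially
detected by a one-dimensional code; for such codes the usual convention asks for purity.  (For a
one-dimensional stabilizer code the minimum distance is then the least weight of a nonidentity
element of its stabilizer.) -/
def GoodError (Q : Submodule ℂ (QuditSpace F N)) (E : QuditOp F N) : Prop :=
  (Module.finrank ℂ Q ≠ 1 → Detects Q E) ∧ (Module.finrank ℂ Q = 1 → DetectsPurely Q E)

/-- `Q` has minimum distance exactly `d`: all errors acting on at most `d - 1` tensor factors are
detected or have no effect on `Q`, and this fails for some error acting on `d` tensor factors. -/
def HasMinDistance (Q : Submodule ℂ (QuditSpace F N)) (d : ℕ) : Prop :=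
  (∀ (T : Finset (Fin N)) (E : QuditOp F N), T.card < d → ActsOn T E → GoodError Q E) ∧
    ∃ (T : Finset (Fin N)) (E : QuditOp F N), T.card = d ∧ ActsOn T E ∧ ¬ GoodError Q E

/-- `Q` is an `[[N, κ, d]]_q` stabilizer code, `q = |F|`. -/
def IsStabilizerCodeWithParams (Q : Submodule ℂ (QuditSpace F N)) (κ d : ℕ) : Prop :=
  IsStabilizerCode Q ∧ Module.finrank ℂ Q = Fintype.card F ^ κ ∧ HasMinDistance Q d

end Quantum

end

open scoped Matrix

noncomputable section

/-! ### Error operators -/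

section ErrorOperators

/-! Restrict the Hermitian inner product to `C`. Its radical is the hull `C ∩ C^⊥`, so its rank is
`e`. Since the norm from `K` to `F` is surjective, the form can be diagonalized and written as minus
the pullback of the standard form on `K^e` along a linear map `φ : C → K^e`
(`exists_hermitian_diagonalization`). A rank count shows that `φ` is surjective with the hull as
kernel, and the graph `{(c, φ c)}` is a self-orthogonal code of length `n + e` and dimension `k`
(`exists_selfOrthogonal_extension`).

Writing `K = F + ωF` identifies vectors over `K` with error operators `X(a)Z(b)`, matching Hamming
weight with the number of affected factors. The symplectic form that governs commutation is, up to a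
constant, `⟨u,v⟩ - ⟨u,v⟩^q`. A self-orthogonal code therefore gives commuting errors, whose joint
eigenspace has dimension `q^(N - 2 dim)` by a trace computation. Its distance is the least weight in
the dual outside the code, or of a nonzero codeword if the code is self-dual
(`exists_stabilizerCode_of_le_hermDual`).

For the weights, take `(b, y)` in the dual of the graph and `c` with `φ c = y`; then `b - c ∈ C^⊥`.
If `y = 0`, then `b ∈ C^⊥`; otherwise `b ∈ C + C^⊥` and `y` contributes at least 1. If `(b, y)` is
not in the graph, then `b ∉ C`. -/

theorem ActsOn.apply_eq_zero {F : Type*} [DecidableEq F] {N : ℕ} {T : Finset (Fin N)} {E : QuditOp F N} (h : ActsOn T E)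
    {x y : Fin N → F} {i : Fin N} (hi : i ∉ T) (hxy : x i ≠ y i) : E x y = 0 := by
  obtain ⟨A, hA⟩ := h
  rw [hA, if_neg]
  exact fun H => hxy (H i hi)

theorem ActsOn.apply_add {F : Type*} [Field F] [DecidableEq F] {N : ℕ} {T : Finset (Fin N)} {E : QuditOp F N} (h : ActsOn T E)
    (x y : Fin N → F) {z : Fin N → F} (hz : ∀ i ∈ T, z i = 0) : E (x + z) (y + z) = E x y := by
  obtain ⟨A, hA⟩ := h
  have (w : Fin N → F) : (fun i : T => (w + z) i) = fun i : T => w i :=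
    funext fun i => by simp [hz i i.2]
  rw [hA, hA, this, this]
  simp

variable {F : Type*} [Field F] [Fintype F] {N : ℕ}

theorem exists_errChar_mul_ne_one {a : F} (ha : a ≠ 0) : ∃ t : F, errChar F (a * t) ≠ 1 := by
  let _ : Algebra (ZMod (ringChar F)) F := ZMod.algebra F (ringChar F)
  have : NeZero (ringChar F) := ⟨CharP.ringChar_ne_zero_of_finite F⟩
  obtain ⟨t, ht⟩ := FiniteField.trace_to_zmod_nondegenerate F ha
  refine ⟨t, fun h => ht (ZMod.injective_stdAddChar ?_)⟩
  rw [AddChar.map_zero_eq_one]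
  exact h

theorem star_errChar (x : F) : star (errChar F x) = errChar F (-x) :=
  (AddChar.map_neg_eq_conj (errChar F) x).symm

theorem sum_errChar_dotProduct [DecidableEq F] (w : Fin N → F) :
    ∑ b : Fin N → F, errChar F (b ⬝ᵥ w) = if w = 0 then (Fintype.card F : ℂ) ^ N else 0 := by
  split_ifs with hw
  · simp [hw, AddChar.map_zero_eq_one]
  · obtain ⟨i, hi⟩ := Function.ne_iff.mp hw
    obtain ⟨t, ht⟩ := exists_errChar_mul_ne_one hi
    let ψ : AddChar (Fin N → F) ℂ :=
      { toFun := fun b => errChar F (b ⬝ᵥ w)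
        map_zero_eq_one' := by simp [AddChar.map_zero_eq_one]
        map_add_eq_mul' := fun a b => by rw [add_dotProduct, AddChar.map_add_eq_mul] }
    refine AddChar.sum_eq_zero_of_ne_one (ψ := ψ) fun h => ht ?_
    have h1 : ψ (Pi.single i t) = 1 := by rw [h]; rfl
    have h2 : ψ (Pi.single i t) = errChar F (Pi.single i t ⬝ᵥ w) := rfl
    rw [h2, single_dotProduct, mul_comm] at h1
    exact h1

variable [DecidableEq F]

/-- The error operator `X(a) Z(b)` of the pair `u = (a, b)`. -/
abbrev err (u : (Fin N → F) × (Fin N → F)) : QuditOp F N := errorOp u.1 u.2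

theorem errorOp_apply (a b x y : Fin N → F) :
    errorOp a b x y = if x = y + a then errChar F (b ⬝ᵥ y) else 0 := rfl

theorem errorOp_mulVec_apply (a b : Fin N → F) (v : QuditSpace F N) (x : Fin N → F) :
    (errorOp a b *ᵥ v) x = errChar F (b ⬝ᵥ (x - a)) * v (x - a) := by
  rw [Matrix.mulVec, dotProduct, Finset.sum_eq_single (x - a)]
  · simp [errorOp_apply]
  · intro y _ hy
    rw [errorOp_apply, if_neg, zero_mul]
    rintro rfl
    simp at hy
  · simp

theorem err_mul (u v : (Fin N → F) × (Fin N → F)) :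
    err u * err v = errChar F (u.2 ⬝ᵥ v.1) • err (u + v) := by
  refine Matrix.toLin'.injective (LinearMap.ext fun w => funext fun x => ?_)
  simp only [Matrix.toLin'_apply, ← Matrix.mulVec_mulVec, Matrix.smul_mulVec, Pi.smul_apply,
    errorOp_mulVec_apply, smul_eq_mul, Prod.fst_add, Prod.snd_add, sub_sub, ← mul_assoc,
    ← AddChar.map_add_eq_mul]
  congr 2
  rw [add_dotProduct, ← add_assoc, ← dotProduct_add]
  congr 2
  abel_nf

theorem err_zero : err (0 : (Fin N → F) × (Fin N → F)) = 1 := by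
  ext x y
  simp [errorOp_apply, Matrix.one_apply, AddChar.map_zero_eq_one]

/-- The commutator phase of two error operators. -/
def commPhase (u v : (Fin N → F) × (Fin N → F)) : ℂ := errChar F (u.2 ⬝ᵥ v.1 - v.2 ⬝ᵥ u.1)

theorem err_mul_comm (u v : (Fin N → F) × (Fin N → F)) :
    err u * err v = commPhase u v • (err v * err u) := by
  rw [err_mul, err_mul, smul_smul, commPhase, ← AddChar.map_add_eq_mul, add_comm v u,
    sub_add_cancel]

theorem trace_err (u : (Fin N → F) × (Fin N → F)) :
    (err u).trace = if u = 0 then (Fintype.card F : ℂ) ^ N else 0 := by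
  simp only [Matrix.trace, Matrix.diag_apply, errorOp_apply, left_eq_add]
  by_cases h : u.1 = 0
  · simp only [h, if_true, dotProduct_comm u.2, sum_errChar_dotProduct]
    simp [Prod.ext_iff, h]
  · simp [Prod.ext_iff, h]

theorem conjTranspose_err_mul (u : (Fin N → F) × (Fin N → F)) : (err u)ᴴ * err u = 1 := by
  ext x y
  rw [Matrix.mul_apply, Finset.sum_eq_single (y + u.1)]
  · by_cases h : x = y
    · subst h
      simp [errorOp_apply, ← AddChar.map_neg_eq_conj, ← AddChar.map_add_eq_mul,
        AddChar.map_zero_eq_one]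
    · have : ¬ y = x := fun h' => h h'.symm
      simp [errorOp_apply, h, this]
  · intro z _ hz
    simp [errorOp_apply u.1 u.2 z y, hz]
  · simp

theorem err_mulVec_eq_zero {u : (Fin N → F) × (Fin N → F)} {v : QuditSpace F N}
    (h : err u *ᵥ v = 0) : v = 0 := by
  rw [← Matrix.one_mulVec v, ← conjTranspose_err_mul u, ← Matrix.mulVec_mulVec, h,
    Matrix.mulVec_zero]

theorem star_err_mulVec_dotProduct (u : (Fin N → F) × (Fin N → F)) (v w : QuditSpace F N) :
    star (err u *ᵥ v) ⬝ᵥ (err u *ᵥ w) = star v ⬝ᵥ w := by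
  rw [Matrix.star_mulVec, Matrix.dotProduct_mulVec, Matrix.vecMul_vecMul, conjTranspose_err_mul,
    Matrix.vecMul_one]

/-- The coefficient of `err u` in the expansion of an operator in error operators. -/
def errCoeff (E : QuditOp F N) (u : (Fin N → F) × (Fin N → F)) : ℂ :=
  ((Fintype.card F : ℂ) ^ N)⁻¹ * ∑ z, E (z + u.1) z * errChar F (-(u.2 ⬝ᵥ z))

/-- For fixed `a`, the operators `X(a)Z(b)` are supported on the entries with `x - y = a`; on these
the claim is Fourier inversion in `b`. -/
theorem sum_errCoeff_smul (E : QuditOp F N) : ∑ u, errCoeff E u • err u = E := by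
  ext x y
  have hq : ((Fintype.card F : ℂ) ^ N) ≠ 0 :=
    pow_ne_zero _ (Nat.cast_ne_zero.mpr Fintype.card_ne_zero)
  simp only [Matrix.sum_apply, Matrix.smul_apply, smul_eq_mul]
  rw [Fintype.sum_prod_type, Finset.sum_eq_single (x - y)]
  · simp only [errorOp_apply, add_sub_cancel, if_true, errCoeff, mul_assoc, Finset.sum_mul,
      ← AddChar.map_add_eq_mul]
    rw [← Finset.mul_sum, Finset.sum_comm]
    simp only [← Finset.mul_sum, neg_add_eq_sub, ← dotProduct_sub, sum_errChar_dotProduct,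
      sub_eq_zero]
    simp [hq, mul_comm]
  · intro a _ ha
    refine Finset.sum_eq_zero fun b _ => ?_
    change _ * errorOp a b x y = 0
    rw [errorOp_apply, if_neg, mul_zero]
    rintro rfl
    simp at ha
  · simp

/-- If `u.1 i ≠ 0`, every entry in the sum vanishes. If `u.2 i ≠ 0`, translating coordinate `i`
leaves the entries of `E` unchanged but multiplies the sum by a character value that can be chosen
different from 1. -/
theorem ActsOn.errCoeff_eq_zero {T : Finset (Fin N)} {E : QuditOp F N} (h : ActsOn T E)
    {u : (Fin N → F) × (Fin N → F)} {i : Fin N} (hi : i ∉ T) (hu : u.1 i ≠ 0 ∨ u.2 i ≠ 0) :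
    errCoeff E u = 0 := by
  rw [errCoeff]
  refine mul_eq_zero_of_right _ ?_
  rcases hu with hu | hu
  · refine Finset.sum_eq_zero fun z _ => ?_
    rw [h.apply_eq_zero hi (by simpa using hu), zero_mul]
  · obtain ⟨t, ht⟩ := exists_errChar_mul_ne_one (neg_ne_zero.mpr hu)
    set S := ∑ z, E (z + u.1) z * errChar F (-(u.2 ⬝ᵥ z)) with hS
    have hsum : S = S * errChar F (-u.2 i * t) := by
      conv_lhs => rw [hS, ← Equiv.sum_comp (Equiv.addRight (Pi.single i t : Fin N → F))]
      rw [hS, Finset.sum_mul]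
      refine Finset.sum_congr rfl fun z _ => ?_
      rw [Equiv.coe_addRight, add_right_comm, h.apply_add, mul_assoc, ← AddChar.map_add_eq_mul,
        dotProduct_add, dotProduct_single, neg_add, neg_mul]
      intro j hj
      rw [Pi.single_apply, if_neg]
      rintro rfl
      exact hi hj
    have : S * (errChar F (-u.2 i * t) - 1) = 0 := by rw [mul_sub, ← hsum]; ring
    exact (mul_eq_zero.mp this).resolve_right (sub_ne_zero.mpr ht)

theorem ActsOn.err {T : Finset (Fin N)} {u : (Fin N → F) × (Fin N → F)}
    (hu : ∀ i ∉ T, u.1 i = 0 ∧ u.2 i = 0) : ActsOn T (err u) := by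
  refine ⟨Matrix.of fun s t => if s = t + (fun i : T => u.1 i) then
    errChar F ((fun i : T => u.2 i) ⬝ᵥ t) else 0, fun x y => ?_⟩
  change errorOp u.1 u.2 x y = _
  rw [errorOp_apply, Matrix.of_apply]
  have hdot : (fun i : T => u.2 i) ⬝ᵥ (fun i : T => y i) = u.2 ⬝ᵥ y := by
    simp only [dotProduct]
    rw [Finset.sum_coe_sort T (fun i => u.2 i * y i)]
    exact Finset.sum_subset (Finset.subset_univ T) fun i _ hi => by simp [(hu i hi).2]
  rw [hdot, ← ite_and]
  refine if_congr ?_ rfl rfl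
  simp only [funext_iff, Pi.add_apply, Subtype.forall]
  constructor
  · exact fun h => ⟨fun i hi => by rw [h, (hu i hi).1, add_zero], fun i _ => h i⟩
  · intro h i
    by_cases hi : i ∈ T
    · exact h.2 i hi
    · rw [h.1 i hi, (hu i hi).1, add_zero]

end ErrorOperators

/-! ### Stabilizer codes from isotropic groups of error operators -/

/-- A commuting family of endomorphisms of a nonzero finite-dimensional space over an
algebraically closed field has a common eigenvector. -/
theorem Module.End.exists_common_eigenvector {K ι V : Type*} [Field K] [IsAlgClosed K]
    [AddCommGroup V] [Module K V] [FiniteDimensional K V] [Nontrivial V]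
    (f : ι → Module.End K V) (hf : ∀ i j, Commute (f i) (f j)) :
    ∃ v : V, v ≠ 0 ∧ ∀ i, ∃ μ : K, f i v = μ • v := by
  induction hd : Module.finrank K V using Nat.strong_induction_on generalizing V with
  | _ d ih =>
    by_cases h : ∀ i, ∃ μ : K, ∀ v, f i v = μ • v
    · obtain ⟨v, hv⟩ := exists_ne (0 : V)
      exact ⟨v, hv, fun i => (h i).imp fun μ hμ => hμ v⟩
    · push Not at h
      obtain ⟨i, hi⟩ := h
      obtain ⟨μ, hμ⟩ := Module.End.exists_eigenvalue (f i)
      obtain ⟨w, hw⟩ := hi μ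
      -- A non-scalar member has a proper nonzero eigenspace, stable under the whole family by
      -- commutation; the induction continues there.
      set W := (f i).eigenspace μ with hW
      have hlt : W < ⊤ := lt_top_iff_ne_top.mpr fun h => hw
        (Module.End.mem_eigenspace_iff.mp (h ▸ Submodule.mem_top : w ∈ W))
      have hmaps (j : ι) : ∀ x ∈ W, f j x ∈ W := fun x hx => by
        rw [hW, Module.End.mem_eigenspace_iff] at hx ⊢
        have := LinearMap.congr_fun (hf i j) x
        simp only [Module.End.mul_apply] at this
        rw [this, hx, map_smul]
      have : Nontrivial W := Submodule.nontrivial_iff_ne_bot.mpr hμ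
      obtain ⟨v, hv, hv'⟩ := ih _ (hd ▸ Submodule.finrank_lt hlt.ne)
        (fun j => (f j).restrict (hmaps j))
        (fun j k => LinearMap.ext fun x => Subtype.ext (LinearMap.congr_fun (hf j k) (x : V))) rfl
      exact ⟨v, by simpa using hv, fun j => (hv' j).imp fun ν hν => congrArg Subtype.val hν⟩

open scoped ComplexOrder in
theorem eq_zero_of_star_dotProduct_self {ι : Type*} [Fintype ι] {v : ι → ℂ}
    (h : star v ⬝ᵥ v = 0) : v = 0 :=
  dotProduct_star_self_eq_zero.mp h

section Stabilizer

variable {F : Type*} [Field F] [Fintype F] [DecidableEq F] {N : ℕ}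

/-- Phases `c` for which `u ↦ c u • err u` is a homomorphism from `D` to the unitary group. -/
structure IsPhaseLift (D : AddSubgroup ((Fin N → F) × (Fin N → F)))
    (c : (Fin N → F) × (Fin N → F) → ℂ) : Prop where
  star_mul_self : ∀ u ∈ D, star (c u) * c u = 1
  map_add : ∀ u ∈ D, ∀ v ∈ D, c u * c v * errChar F (u.2 ⬝ᵥ v.1) = c (u + v)

/-- The phases are read off a common eigenvector `ψ`: the inverse eigenvalues make every operator
fix `ψ`, which forces multiplicativity in every characteristic alike. -/
theorem exists_isPhaseLift (D : AddSubgroup ((Fin N → F) × (Fin N → F)))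
    (hD : ∀ u ∈ D, ∀ v ∈ D, commPhase u v = 1) : ∃ c, IsPhaseLift D c := by
  obtain ⟨ψ, hψ, h⟩ := Module.End.exists_common_eigenvector
    (fun u : D => Matrix.toLin' (err u.1)) (fun u v => by
      rw [Commute, SemiconjBy, Module.End.mul_eq_comp, Module.End.mul_eq_comp,
        ← Matrix.toLin'_mul, ← Matrix.toLin'_mul, err_mul_comm, hD u u.2 v v.2, one_smul])
  choose μ hμ using h
  simp only [Matrix.toLin'_apply] at hμ
  have hψ' : star ψ ⬝ᵥ ψ ≠ 0 := fun h => hψ (eq_zero_of_star_dotProduct_self h)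
  have hunit (u : D) : star (μ u) * μ u = 1 := by
    have := star_err_mulVec_dotProduct u.1 ψ ψ
    rw [hμ, star_smul, smul_dotProduct, dotProduct_smul, smul_eq_mul, smul_eq_mul,
      ← mul_assoc] at this
    exact mul_right_cancel₀ hψ' (this.trans (one_mul _).symm)
  have hmul (u v : D) : μ u * μ v = errChar F (u.1.2 ⬝ᵥ v.1.1) * μ (u + v) := by
    have : (err u.1 * err v.1) *ᵥ ψ = (μ u * μ v) • ψ := by
      rw [← Matrix.mulVec_mulVec, hμ, Matrix.mulVec_smul, hμ, smul_smul, mul_comm]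
    rw [err_mul, Matrix.smul_mulVec, ← AddSubgroup.coe_add, hμ, smul_smul] at this
    exact (smul_left_injective ℂ hψ this).symm
  classical
  refine ⟨fun u => if h : u ∈ D then star (μ ⟨u, h⟩) else 0, fun u hu => ?_, fun u hu v hv => ?_⟩
  · simpa [hu, mul_comm] using hunit ⟨u, hu⟩
  · simp only [hu, hv, D.add_mem hu hv, dif_pos]
    have := congrArg star (hmul ⟨u, hu⟩ ⟨v, hv⟩)
    simp only [star_mul', star_errChar] at this
    rw [this, mul_right_comm, ← AddChar.map_add_eq_mul, neg_add_cancel, AddChar.map_zero_eq_one,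
      one_mul]
    rfl

/-- The joint `+1`-eigenspace of the operators `c u • err u`, `u ∈ D`. -/
def stabCode (D : AddSubgroup ((Fin N → F) × (Fin N → F)))
    (c : (Fin N → F) × (Fin N → F) → ℂ) : Submodule ℂ (QuditSpace F N) where
  carrier := {v | ∀ u ∈ D, (c u • err u) *ᵥ v = v}
  zero_mem' := fun u _ => Matrix.mulVec_zero _
  add_mem' := fun {v w} hv hw u hu => by rw [Matrix.mulVec_add, hv u hu, hw u hu]
  smul_mem' := fun r v hv u hu => by rw [Matrix.mulVec_smul, hv u hu]

open Classical in
/-- The average of the operators `c u • err u`, `u ∈ D`. -/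
def stabProj (D : AddSubgroup ((Fin N → F) × (Fin N → F)))
    (c : (Fin N → F) × (Fin N → F) → ℂ) : QuditOp F N :=
  (Nat.card D : ℂ)⁻¹ • ∑ u : D, c u.1 • err u.1

namespace IsPhaseLift

variable {D : AddSubgroup ((Fin N → F) × (Fin N → F))} {c : (Fin N → F) × (Fin N → F) → ℂ}

omit [DecidableEq F] in
theorem ne_zero (hc : IsPhaseLift D c) {u : (Fin N → F) × (Fin N → F)} (hu : u ∈ D) :
    c u ≠ 0 := fun h => by simpa [h] using hc.star_mul_self u hu

theorem mul (hc : IsPhaseLift D c) {u v : (Fin N → F) × (Fin N → F)} (hu : u ∈ D) (hv : v ∈ D) :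
    (c u • err u) * (c v • err v) = c (u + v) • err (u + v) := by
  rw [smul_mul_smul_comm, err_mul, smul_smul, hc.map_add u hu v hv]

omit [DecidableEq F] in
theorem map_zero (hc : IsPhaseLift D c) : c 0 = 1 := by
  have := hc.map_add 0 D.zero_mem 0 D.zero_mem
  simpa [AddChar.map_zero_eq_one, hc.ne_zero D.zero_mem] using this

theorem stabProj_mulVec_of_mem {v : QuditSpace F N} (hv : v ∈ stabCode D c) :
    stabProj D c *ᵥ v = v := by
  classical
  have h0 : (Nat.card D : ℂ) ≠ 0 := Nat.cast_ne_zero.mpr Nat.card_pos.ne'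
  rw [stabProj, Matrix.smul_mulVec, Matrix.sum_mulVec,
    Finset.sum_congr rfl fun u _ => hv u.1 u.2, Finset.sum_const, Finset.card_univ,
    ← Nat.card_eq_fintype_card, ← Nat.cast_smul_eq_nsmul ℂ, smul_smul, inv_mul_cancel₀ h0, one_smul]

theorem stabProj_mulVec_mem (hc : IsPhaseLift D c) (v : QuditSpace F N) :
    stabProj D c *ᵥ v ∈ stabCode D c := by
  classical
  intro u hu
  rw [Matrix.mulVec_mulVec, stabProj, Matrix.mul_smul, Finset.mul_sum]
  congr 2
  rw [← Equiv.sum_comp (Equiv.addLeft (⟨u, hu⟩ : D)) fun u : D => c u.1 • err u.1]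
  exact Finset.sum_congr rfl fun w _ => hc.mul hu w.2

theorem trace_err_mul_stabProj {w : (Fin N → F) × (Fin N → F)} (hw : w ∉ D) :
    (err w * stabProj D c).trace = 0 := by
  rw [stabProj, Matrix.mul_smul, Finset.mul_sum, Matrix.trace_smul, Matrix.trace_sum]
  refine smul_eq_zero_of_right _ (Finset.sum_eq_zero fun u _ => ?_)
  rw [Matrix.mul_smul, err_mul, Matrix.trace_smul, Matrix.trace_smul, trace_err, if_neg]
  · simp
  · intro h
    exact hw (eq_neg_of_add_eq_zero_left h ▸ D.neg_mem u.2)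

theorem trace_stabProj (hc : IsPhaseLift D c) :
    (stabProj D c).trace = (Nat.card D : ℂ)⁻¹ * (Fintype.card F : ℂ) ^ N := by
  rw [stabProj, Matrix.trace_smul, Matrix.trace_sum, Finset.sum_eq_single (0 : D)]
  · simp [trace_err, hc.map_zero]
  · intro u _ hu
    rw [Matrix.trace_smul, trace_err, if_neg (by simpa using hu), smul_zero]
  · simp

theorem trace_stabProj_eq_finrank (hc : IsPhaseLift D c) :
    (stabProj D c).trace = Module.finrank ℂ (stabCode D c) := by
  have h : LinearMap.IsProj (stabCode D c) (Matrix.toLin' (stabProj D c)) :=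
    ⟨fun v => by rw [Matrix.toLin'_apply]; exact hc.stabProj_mulVec_mem v,
      fun v hv => by rw [Matrix.toLin'_apply]; exact stabProj_mulVec_of_mem hv⟩
  rw [← h.trace, Matrix.trace_toLin'_eq]

/-- The trace of the averaging projection is computed twice: as the dimension of its range, and
termwise, where only the identity contributes. -/
theorem card_mul_finrank (hc : IsPhaseLift D c) :
    Nat.card D * Module.finrank ℂ (stabCode D c) = Fintype.card F ^ N := by
  have h0 : (Nat.card D : ℂ) ≠ 0 := Nat.cast_ne_zero.mpr Nat.card_pos.ne'
  have := hc.trace_stabProj_eq_finrank.symm.trans hc.trace_stabProj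
  rw [eq_inv_mul_iff_mul_eq₀ h0] at this
  exact_mod_cast this

theorem finrank_pos (hc : IsPhaseLift D c) : 0 < Module.finrank ℂ (stabCode D c) := by
  refine Nat.pos_of_ne_zero fun h => ?_
  have := hc.card_mul_finrank
  rw [h, mul_zero] at this
  exact (pow_pos Fintype.card_pos N).ne this

theorem stabCode_ne_bot (hc : IsPhaseLift D c) : stabCode D c ≠ ⊥ := fun h => by
  have := hc.finrank_pos
  rw [h, finrank_bot] at this
  exact this.ne rfl

theorem smul_err_mem_unitaryGroup (hc : IsPhaseLift D c) {u : (Fin N → F) × (Fin N → F)}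
    (hu : u ∈ D) : c u • err u ∈ Matrix.unitaryGroup (Fin N → F) ℂ := by
  rw [Matrix.mem_unitaryGroup_iff', Matrix.star_eq_conjTranspose, Matrix.conjTranspose_smul,
    smul_mul_smul_comm, hc.star_mul_self u hu, conjTranspose_err_mul, one_smul]

theorem isStabilizerCode (hc : IsPhaseLift D c) : IsStabilizerCode (stabCode D c) := by
  refine ⟨hc.stabCode_ne_bot, ?_⟩
  let φ : Multiplicative D →* Matrix.unitaryGroup (Fin N → F) ℂ :=
    { toFun := fun u => ⟨c u.toAdd.1 • err u.toAdd.1, hc.smul_err_mem_unitaryGroup u.toAdd.2⟩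
      map_one' := Subtype.ext (by simp [hc.map_zero, err_zero])
      map_mul' := fun u v => Subtype.ext (hc.mul u.toAdd.2 v.toAdd.2).symm }
  refine ⟨φ.range, ?_, ?_, fun v => ⟨?_, fun h u hu => ?_⟩⟩
  · rintro _ ⟨u, rfl⟩ _ ⟨v, rfl⟩
    rw [← map_mul, mul_comm, map_mul]
  · rintro _ ⟨u, rfl⟩
    exact ⟨_, _, _, rfl⟩
  · rintro hv _ ⟨u, rfl⟩
    exact hv _ u.toAdd.2
  · exact h _ ⟨Multiplicative.ofAdd ⟨u, hu⟩, rfl⟩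

/-- Moving the stabilizer element of `u` past `err w` shows that the matrix element equals itself
times a phase different from 1. -/
theorem star_dotProduct_err_mulVec_eq_zero (hc : IsPhaseLift D c)
    {w u : (Fin N → F) × (Fin N → F)} (hu : u ∈ D) (hwu : commPhase w u ≠ 1)
    {v v' : QuditSpace F N} (hv : v ∈ stabCode D c) (hv' : v' ∈ stabCode D c) :
    star v ⬝ᵥ (err w *ᵥ v') = 0 := by
  have key : star v ⬝ᵥ (err w *ᵥ v') = commPhase w u * (star v ⬝ᵥ (err w *ᵥ v')) := by
    have h' : err w *ᵥ v' = (c u * commPhase w u) • (err u *ᵥ (err w *ᵥ v')) := by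
      conv_lhs => rw [← hv' u hu]
      rw [Matrix.smul_mulVec, Matrix.mulVec_smul, Matrix.mulVec_mulVec, err_mul_comm,
        Matrix.smul_mulVec, smul_smul, Matrix.mulVec_mulVec]
    conv_lhs => rw [← hv u hu, h']
    rw [Matrix.smul_mulVec, star_smul, smul_dotProduct, dotProduct_smul, smul_eq_mul, smul_eq_mul,
      star_err_mulVec_dotProduct, ← mul_assoc, ← mul_assoc, hc.star_mul_self u hu, one_mul]
  by_contra h
  exact hwu (mul_right_cancel₀ h (key.symm.trans (one_mul _).symm))

theorem err_mulVec_of_mem (hc : IsPhaseLift D c) {u : (Fin N → F) × (Fin N → F)} (hu : u ∈ D)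
    {v : QuditSpace F N} (hv : v ∈ stabCode D c) : err u *ᵥ v = (c u)⁻¹ • v := by
  conv_rhs => rw [← hv u hu]
  rw [Matrix.smul_mulVec, smul_smul, inv_mul_cancel₀ (hc.ne_zero hu), one_smul]

theorem err_mulVec_mem {w : (Fin N → F) × (Fin N → F)}
    (hw : ∀ u ∈ D, commPhase w u = 1) {v : QuditSpace F N} (hv : v ∈ stabCode D c) :
    err w *ᵥ v ∈ stabCode D c := by
  intro u hu
  conv_rhs => rw [← hv u hu]
  rw [Matrix.mulVec_mulVec, Matrix.mulVec_mulVec, smul_mul_assoc, mul_smul_comm, err_mul_comm w,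
    hw u hu, one_smul]

/-- An undisturbed `err w` preserves the code, so detection makes it a scalar `a` there. As `w ∉ D`,
its product with the projection has trace 0, hence `a = 0`, which a unitary operator excludes. -/
theorem not_detects (hc : IsPhaseLift D c) {w : (Fin N → F) × (Fin N → F)} (hwD : w ∉ D)
    (hw : ∀ u ∈ D, commPhase w u = 1) : ¬ Detects (stabCode D c) (err w) := by
  rintro ⟨a, ha⟩
  have hscalar : ∀ v ∈ stabCode D c, err w *ᵥ v = a • v := by
    intro v hv
    have hx : err w *ᵥ v - a • v ∈ stabCode D c :=
      Submodule.sub_mem _ (err_mulVec_mem hw hv) (Submodule.smul_mem _ _ hv)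
    have h0 : star (err w *ᵥ v - a • v) ⬝ᵥ (err w *ᵥ v - a • v) = 0 := by
      rw [dotProduct_sub, ha _ hx v hv, dotProduct_smul, smul_eq_mul, sub_self]
    exact sub_eq_zero.mp (eq_zero_of_star_dotProduct_self h0)
  have hmul : err w * stabProj D c = a • stabProj D c := by
    refine Matrix.toLin'.injective (LinearMap.ext fun v => ?_)
    rw [Matrix.toLin'_apply, Matrix.toLin'_apply, ← Matrix.mulVec_mulVec, Matrix.smul_mulVec,
      hscalar _ (hc.stabProj_mulVec_mem v)]
  have htr := congrArg Matrix.trace hmul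
  rw [trace_err_mul_stabProj hwD, Matrix.trace_smul, hc.trace_stabProj_eq_finrank, smul_eq_mul]
    at htr
  have ha0 : a = 0 := (mul_eq_zero.mp htr.symm).resolve_right
    (Nat.cast_ne_zero.mpr hc.finrank_pos.ne')
  refine hc.stabCode_ne_bot ((Submodule.eq_bot_iff _).mpr fun v hv => err_mulVec_eq_zero (u := w) ?_)
  rw [hscalar v hv, ha0, zero_smul]

theorem not_detectsPurely (hc : IsPhaseLift D c) {w : (Fin N → F) × (Fin N → F)} (hwD : w ∈ D)
    (hw : w ≠ 0) : ¬ DetectsPurely (stabCode D c) (err w) := by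
  intro h
  obtain ⟨v, hv, hv0⟩ := Submodule.exists_mem_ne_zero_of_ne_bot hc.stabCode_ne_bot
  have := h v hv v hv
  rw [trace_err, if_neg hw, zero_div, zero_mul, hc.err_mulVec_of_mem hwD hv, dotProduct_smul,
    smul_eq_zero, inv_eq_zero] at this
  exact this.elim (hc.ne_zero hwD) fun h => hv0 (eq_zero_of_star_dotProduct_self h)

theorem detects_err (hc : IsPhaseLift D c) {w : (Fin N → F) × (Fin N → F)}
    (hw : (∀ u ∈ D, commPhase w u = 1) → w ∈ D) : Detects (stabCode D c) (err w) := by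
  by_cases hwD : w ∈ D
  · exact ⟨(c w)⁻¹, fun u _ v hv => by
      rw [hc.err_mulVec_of_mem hwD hv, dotProduct_smul, smul_eq_mul]⟩
  · have := mt hw hwD
    push Not at this
    obtain ⟨u, hu, hwu⟩ := this
    exact ⟨0, fun v hv v' hv' => by
      rw [zero_mul, hc.star_dotProduct_err_mulVec_eq_zero hu hwu hv hv']⟩

theorem detectsPurely_err (hc : IsPhaseLift D c) {w : (Fin N → F) × (Fin N → F)}
    (hw : (∀ u ∈ D, commPhase w u = 1) → w = 0) : DetectsPurely (stabCode D c) (err w) := by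
  intro v hv v' hv'
  rw [trace_err]
  split_ifs with h0
  · have hq : ((Fintype.card F : ℂ) ^ N) ≠ 0 :=
      pow_ne_zero _ (Nat.cast_ne_zero.mpr Fintype.card_ne_zero)
    rw [h0, err_zero, Matrix.one_mulVec, div_self hq, one_mul]
  · have := mt hw h0
    push Not at this
    obtain ⟨u, hu, hwu⟩ := this
    rw [zero_div, zero_mul, hc.star_dotProduct_err_mulVec_eq_zero hu hwu hv hv']

end IsPhaseLift

theorem star_dotProduct_mulVec_eq_sum_errCoeff (E : QuditOp F N) (v v' : QuditSpace F N) :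
    star v ⬝ᵥ (E *ᵥ v') = ∑ w, errCoeff E w * (star v ⬝ᵥ (err w *ᵥ v')) := by
  conv_lhs => rw [← sum_errCoeff_smul E]
  simp only [Matrix.sum_mulVec, dotProduct_sum, Matrix.smul_mulVec, dotProduct_smul, smul_eq_mul]

theorem detects_of_errCoeff {Q : Submodule ℂ (QuditSpace F N)} {E : QuditOp F N}
    (h : ∀ w, errCoeff E w ≠ 0 → Detects Q (err w)) : Detects Q E := by
  choose! a ha using h
  refine ⟨∑ w, errCoeff E w * a w, fun v hv v' hv' => ?_⟩
  rw [star_dotProduct_mulVec_eq_sum_errCoeff, Finset.sum_mul]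
  refine Finset.sum_congr rfl fun w _ => ?_
  by_cases hw : errCoeff E w = 0
  · simp [hw]
  · rw [ha w hw v hv v' hv', mul_assoc]

theorem detectsPurely_of_errCoeff {Q : Submodule ℂ (QuditSpace F N)} {E : QuditOp F N}
    (h : ∀ w, errCoeff E w ≠ 0 → DetectsPurely Q (err w)) : DetectsPurely Q E := by
  intro v hv v' hv'
  conv_rhs => rw [← sum_errCoeff_smul E]
  rw [star_dotProduct_mulVec_eq_sum_errCoeff, Matrix.trace_sum, Finset.sum_div, Finset.sum_mul]
  refine Finset.sum_congr rfl fun w _ => ?_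
  by_cases hw : errCoeff E w = 0
  · simp [hw]
  · rw [h w hw v hv v' hv', Matrix.trace_smul, smul_eq_mul, mul_div_assoc, mul_assoc]

/-- The tensor factors on which `err u` acts nontrivially. -/
def errSupport (u : (Fin N → F) × (Fin N → F)) : Finset (Fin N) :=
  Finset.univ.filter fun i => u.1 i ≠ 0 ∨ u.2 i ≠ 0

theorem actsOn_errSupport (u : (Fin N → F) × (Fin N → F)) : ActsOn (errSupport u) (err u) :=
  ActsOn.err fun i hi => by simpa [errSupport] using hi

theorem ActsOn.errSupport_subset {T : Finset (Fin N)} {E : QuditOp F N} (h : ActsOn T E)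
    {u : (Fin N → F) × (Fin N → F)} (hu : errCoeff E u ≠ 0) : errSupport u ⊆ T := by
  intro i hi
  by_contra hiT
  exact hu (h.errCoeff_eq_zero hiT (by simpa [errSupport] using hi))

namespace IsPhaseLift

variable {D : AddSubgroup ((Fin N → F) × (Fin N → F))} {c : (Fin N → F) × (Fin N → F) → ℂ}

/-- An operator on `T` expands into errors supported in `T`, so by linearity only error operators
matter; a minimal-weight `w` is itself the undetected error. -/
theorem hasMinDistance (hc : IsPhaseLift D c) {d : ℕ}
    (h1 : Module.finrank ℂ (stabCode D c) ≠ 1)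
    (hd : IsLeast {m | ∃ w, w ∉ D ∧ (∀ u ∈ D, commPhase w u = 1) ∧ m = (errSupport w).card} d) :
    HasMinDistance (stabCode D c) d := by
  obtain ⟨⟨w, hwD, hw, hwd⟩, hmin⟩ := hd
  refine ⟨fun T E hT hE => ⟨fun _ => ?_, fun h => absurd h h1⟩,
    errSupport w, err w, hwd.symm, actsOn_errSupport w, fun h => hc.not_detects hwD hw (h.1 h1)⟩
  refine detects_of_errCoeff fun u hu => hc.detects_err fun hu' => ?_
  by_contra huD
  have := hmin ⟨u, huD, hu', rfl⟩
  have := Finset.card_le_card (hE.errSupport_subset hu)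
  omega

theorem hasMinDistance_of_finrank_eq_one (hc : IsPhaseLift D c) {d : ℕ}
    (h1 : Module.finrank ℂ (stabCode D c) = 1)
    (hD : ∀ w, (∀ u ∈ D, commPhase w u = 1) → w ∈ D)
    (hd : IsLeast {m | ∃ w, w ∈ D ∧ w ≠ 0 ∧ m = (errSupport w).card} d) :
    HasMinDistance (stabCode D c) d := by
  obtain ⟨⟨w, hwD, hw, hwd⟩, hmin⟩ := hd
  refine ⟨fun T E hT hE => ⟨fun h => absurd h1 h, fun _ => ?_⟩,
    errSupport w, err w, hwd.symm, actsOn_errSupport w,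
    fun h => hc.not_detectsPurely hwD hw (h.2 h1)⟩
  refine detectsPurely_of_errCoeff fun u hu => hc.detectsPurely_err fun hu' => ?_
  by_contra hu0
  have := hmin ⟨u, hD u hu', hu0, rfl⟩
  have := Finset.card_le_card (hE.errSupport_subset hu)
  omega

end IsPhaseLift

end Stabilizer

/-! ### Quadratic extensions of finite fields -/

section QuadraticExtension

variable {F : Type*} [Field F] [Fintype F] {K : Type*} [Field K] [Algebra F K] {n : ℕ}

theorem add_pow_card_base (x y : K) :
    (x + y) ^ Fintype.card F = x ^ Fintype.card F + y ^ Fintype.card F :=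
  map_add (FiniteField.frobeniusAlgHom F K) x y

theorem sum_pow_card_base {ι : Type*} (s : Finset ι) (f : ι → K) :
    (∑ i ∈ s, f i) ^ Fintype.card F = ∑ i ∈ s, f i ^ Fintype.card F :=
  map_sum (FiniteField.frobeniusAlgHom F K) f s

theorem neg_pow_card_base (x : K) : (-x) ^ Fintype.card F = -x ^ Fintype.card F :=
  map_neg (FiniteField.frobeniusAlgHom F K) x

theorem algebraMap_pow_card_base (a : F) :
    algebraMap F K a ^ Fintype.card F = algebraMap F K a := by
  rw [← map_pow, FiniteField.pow_card]

variable [Fintype K]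

omit [Field F] [Algebra F K] in
theorem pow_card_base_pow_card_base (hK : Fintype.card K = Fintype.card F ^ 2) (x : K) :
    (x ^ Fintype.card F) ^ Fintype.card F = x := by
  rw [← pow_mul, ← sq, ← hK, FiniteField.pow_card]

/-- The relative Frobenius has order `[K : F] = 2`, so it is not the identity. -/
theorem exists_pow_card_base_ne (hK : Fintype.card K = Fintype.card F ^ 2) :
    ∃ ω : K, ω ^ Fintype.card F ≠ ω := by
  by_contra! h
  have h2 : Module.finrank F K = 2 :=
    Nat.pow_right_injective (Fintype.one_lt_card (α := F))
      ((Module.card_eq_pow_finrank (K := F) (V := K)).symm.trans hK)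
  have h1 : FiniteField.frobeniusAlgHom F K = 1 := AlgHom.ext h
  rw [← FiniteField.orderOf_frobeniusAlgHom, h1, orderOf_one] at h2
  omega

theorem eq_zero_of_forall_mul_pow_card_base_eq (hK : Fintype.card K = Fintype.card F ^ 2) {h : K}
    (H : ∀ γ : K, (γ * h) ^ Fintype.card F = γ * h) : h = 0 := by
  obtain ⟨ω, hω⟩ := exists_pow_card_base_ne hK
  have h1 := H 1
  have h2 := H ω
  rw [one_mul] at h1
  rw [mul_pow, h1] at h2
  by_contra h0
  exact hω (mul_right_cancel₀ h0 h2)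

theorem eq_zero_of_forall_mul_pow_card_base_eq_neg (hK : Fintype.card K = Fintype.card F ^ 2)
    {h : K} (H : ∀ γ : K, (γ * h) ^ Fintype.card F = -(γ * h)) : h = 0 := by
  obtain ⟨ω, hω⟩ := exists_pow_card_base_ne hK
  have h1 := H 1
  have h2 := H ω
  rw [one_mul] at h1
  rw [mul_pow, h1, mul_neg, neg_inj] at h2
  by_contra h0
  exact hω (mul_right_cancel₀ h0 h2)

omit [Fintype K] in
theorem algebraMap_add_mul_eq_zero {ω : K} (hω : ω ^ Fintype.card F ≠ ω) {a b : F} :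
    algebraMap F K a + ω * algebraMap F K b = 0 ↔ a = 0 ∧ b = 0 := by
  refine ⟨fun h => ?_, fun h => by simp [h.1, h.2]⟩
  have h' := congrArg (· ^ Fintype.card F) h
  simp only [add_pow_card_base, mul_pow, algebraMap_pow_card_base,
    zero_pow (Fintype.card_ne_zero (α := F))] at h'
  have hb : b = 0 := by
    have : (ω ^ Fintype.card F - ω) * algebraMap F K b = 0 := by linear_combination h' - h
    simpa [sub_ne_zero.mpr hω] using this
  refine ⟨by simpa [hb] using h, hb⟩

/-- The coordinatewise map `(a, b) ↦ a + ω b`. -/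
def pairToExt (ω : K) (n : ℕ) : (Fin n → F) × (Fin n → F) →ₗ[F] Fin n → K where
  toFun u i := algebraMap F K (u.1 i) + ω * algebraMap F K (u.2 i)
  map_add' u v := funext fun i => by simp; ring
  map_smul' r u := funext fun i => by simp [Algebra.smul_def]; ring

omit [Fintype F] [Fintype K] in
theorem pairToExt_apply (ω : K) (u : (Fin n → F) × (Fin n → F)) (i : Fin n) :
    pairToExt ω n u i = algebraMap F K (u.1 i) + ω * algebraMap F K (u.2 i) := rfl

omit [Fintype K] in
theorem pairToExt_injective {ω : K} (hω : ω ^ Fintype.card F ≠ ω) :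
    Function.Injective (pairToExt (F := F) ω n) := by
  rw [injective_iff_map_eq_zero]
  intro u hu
  have (i : Fin n) := (algebraMap_add_mul_eq_zero hω).mp (congrFun hu i)
  exact Prod.ext (funext fun i => (this i).1) (funext fun i => (this i).2)

theorem pairToExt_bijective (hK : Fintype.card K = Fintype.card F ^ 2) {ω : K}
    (hω : ω ^ Fintype.card F ≠ ω) : Function.Bijective (pairToExt (F := F) ω n) := by
  classical
  refine (Fintype.bijective_iff_injective_and_card _).mpr ⟨pairToExt_injective hω, ?_⟩
  simp only [Fintype.card_prod, Fintype.card_fun, Fintype.card_fin, hK]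
  ring

theorem exists_algebraMap_eq_of_pow_card_base_eq (hK : Fintype.card K = Fintype.card F ^ 2) {t : K}
    (ht : t ^ Fintype.card F = t) : ∃ a : F, algebraMap F K a = t := by
  obtain ⟨ω, hω⟩ := exists_pow_card_base_ne hK
  obtain ⟨u, hu⟩ := (pairToExt_bijective (n := 1) hK hω).2 fun _ => t
  have h := congrFun hu 0
  rw [pairToExt_apply] at h
  have h' := ht
  rw [← h] at h'
  simp only [add_pow_card_base, mul_pow, algebraMap_pow_card_base] at h'
  have : (ω ^ Fintype.card F - ω) * algebraMap F K (u.2 0) = 0 := by linear_combination h'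
  have h2 : u.2 0 = 0 := by simpa [sub_ne_zero.mpr hω] using this
  exact ⟨u.1 0, by simpa [h2] using h⟩

theorem exists_mul_pow_card_base_eq (hK : Fintype.card K = Fintype.card F ^ 2) {t : K}
    (ht : t ^ Fintype.card F = t) : ∃ γ : K, γ * γ ^ Fintype.card F = t := by
  obtain ⟨a, rfl⟩ := exists_algebraMap_eq_of_pow_card_base_eq hK ht
  obtain ⟨γ, rfl⟩ := FiniteField.norm_surjective F K a
  refine ⟨γ, ?_⟩
  -- The norm is the power with exponent `(q² - 1)/(q - 1) = q + 1`.
  have h1 : 1 < Fintype.card F := Fintype.one_lt_card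
  rw [FiniteField.algebraMap_norm_eq_pow, Nat.card_eq_fintype_card, Nat.card_eq_fintype_card, hK,
    ← one_pow 2, Nat.sq_sub_sq, one_pow, Nat.mul_div_cancel _ (by omega), pow_succ, mul_comm]

end QuadraticExtension

/-! ### Hermitian duality -/

section HermitianDuality

variable {F : Type*} [Field F] [Fintype F] {K : Type*} [Field K] [Algebra F K] {n : ℕ}

theorem mem_hermDual {C : Submodule K (Fin n → K)} {b : Fin n → K} :
    b ∈ hermDual F C ↔ ∀ c ∈ C, hermInner F c b = 0 := Iff.rfl

omit [Field F] [Algebra F K] in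
theorem hermInner_add_left (u v w : Fin n → K) :
    hermInner F (u + v) w = hermInner F u w + hermInner F v w := by
  simp [hermInner, add_mul, Finset.sum_add_distrib]

omit [Field F] [Algebra F K] in
theorem hermInner_smul_left (r : K) (u w : Fin n → K) :
    hermInner F (r • u) w = r * hermInner F u w := by
  simp [hermInner, Finset.mul_sum, mul_assoc]

omit [Field F] [Algebra F K] in
theorem hermInner_single_one [DecidableEq (Fin n)] (i : Fin n) (w : Fin n → K) :
    hermInner F (Pi.single i 1) w = w i ^ Fintype.card F := by
  simp [hermInner, Pi.single_apply]

/-- The linear functional `u ↦ hermInner F u w`. -/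
def hermFunctional (F : Type*) [Field F] [Fintype F] {K : Type*} [Field K] [Algebra F K] {n : ℕ}
    (w : Fin n → K) : Module.Dual K (Fin n → K) where
  toFun u := hermInner F u w
  map_add' u v := hermInner_add_left u v w
  map_smul' r u := hermInner_smul_left r u w

variable [Fintype K]

theorem hermInner_pow (hK : Fintype.card K = Fintype.card F ^ 2) (u v : Fin n → K) :
    hermInner F u v ^ Fintype.card F = hermInner F v u := by
  simp only [hermInner, sum_pow_card_base, mul_pow, pow_card_base_pow_card_base hK]
  exact Finset.sum_congr rfl fun i _ => mul_comm _ _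

theorem hermFunctional_bijective (hK : Fintype.card K = Fintype.card F ^ 2) :
    Function.Bijective (hermFunctional F : (Fin n → K) → _) := by
  constructor
  · intro v w h
    funext i
    have := LinearMap.congr_fun h (Pi.single i 1)
    simp only [hermFunctional, LinearMap.coe_mk, AddHom.coe_mk, hermInner_single_one] at this
    rw [← pow_card_base_pow_card_base hK (v i), this, pow_card_base_pow_card_base hK]
  · intro f
    refine ⟨fun i => f (Pi.single i 1) ^ Fintype.card F, LinearMap.pi_ext' fun i => ?_⟩
    refine LinearMap.ext_ring ?_
    simp [hermFunctional, hermInner_single_one, pow_card_base_pow_card_base hK]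

/-- The map `w ↦ ⟨·, w⟩` is only Frobenius-semilinear, so the dimensions of the dual and of the
annihilator are compared by counting elements. -/
theorem finrank_add_finrank_hermDual (hK : Fintype.card K = Fintype.card F ^ 2)
    (C : Submodule K (Fin n → K)) :
    Module.finrank K C + Module.finrank K (hermDual F C) = n := by
  have e : hermDual F C ≃ C.dualAnnihilator :=
    (Equiv.ofBijective _ (hermFunctional_bijective hK)).subtypeEquiv fun w => by
      rw [Submodule.mem_dualAnnihilator]
      rfl
  have hcard := Nat.card_congr e
  rw [Module.natCard_eq_pow_finrank (K := K) (V := hermDual F C),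
    Module.natCard_eq_pow_finrank (K := K) (V := C.dualAnnihilator)] at hcard
  have hrank := Nat.pow_right_injective (Finite.one_lt_card (α := K)) hcard
  rw [hrank, Subspace.finrank_add_finrank_dualAnnihilator_eq, Module.finrank_fin_fun]

/-- The bridge between the two dualities: the symplectic form is the "imaginary part" of the
Hermitian form. -/
theorem hermInner_pairToExt_pow_sub (hK : Fintype.card K = Fintype.card F ^ 2) (ω : K)
    (u v : (Fin n → F) × (Fin n → F)) :
    hermInner F (pairToExt ω n u) (pairToExt ω n v) -
        hermInner F (pairToExt ω n u) (pairToExt ω n v) ^ Fintype.card F =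
      (ω ^ Fintype.card F - ω) * algebraMap F K (v.2 ⬝ᵥ u.1 - u.2 ⬝ᵥ v.1) := by
  rw [hermInner_pow hK]
  simp only [hermInner, dotProduct, map_sub, map_sum, map_mul, mul_sub,
    Finset.mul_sum, ← Finset.sum_sub_distrib, pairToExt_apply, add_pow_card_base, mul_pow,
    algebraMap_pow_card_base]
  exact Finset.sum_congr rfl fun i _ => by ring

end HermitianDuality

/-! ### Stabilizer codes from Hermitian self-orthogonal codes -/

section HermitianStabilizer

variable {F : Type*} [Field F] [Fintype F] [DecidableEq F] {K : Type*} [Field K] [Fintype K]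
  [DecidableEq K] [Algebra F K] {N : ℕ}

omit [Fintype K] in
theorem hammingNorm_pairToExt {ω : K} (hω : ω ^ Fintype.card F ≠ ω)
    (u : (Fin N → F) × (Fin N → F)) :
    hammingNorm (pairToExt ω N u) = (errSupport u).card := by
  simp only [hammingNorm, errSupport, pairToExt_apply, ne_eq, algebraMap_add_mul_eq_zero hω,
    not_and_or]

/-- The pairs `(a, b)` with `a + ω b ∈ C`. -/
def pairSubgroup (ω : K) (C : Submodule K (Fin N → K)) :
    AddSubgroup ((Fin N → F) × (Fin N → F)) :=
  C.toAddSubgroup.comap (pairToExt ω N).toAddMonoidHom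

omit [Fintype F] [DecidableEq F] [Fintype K] [DecidableEq K] in
theorem mem_pairSubgroup {ω : K} {C : Submodule K (Fin N → K)}
    {u : (Fin N → F) × (Fin N → F)} : u ∈ pairSubgroup ω C ↔ pairToExt ω N u ∈ C := Iff.rfl

omit [DecidableEq K] [DecidableEq F] in
theorem card_pairSubgroup (hK : Fintype.card K = Fintype.card F ^ 2) {ω : K}
    (hω : ω ^ Fintype.card F ≠ ω) (C : Submodule K (Fin N → K)) :
    Nat.card (pairSubgroup (F := F) ω C) = Fintype.card F ^ (2 * Module.finrank K C) := by
  have e : pairSubgroup (F := F) ω C ≃ C :=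
    (Equiv.ofBijective _ (pairToExt_bijective hK hω)).subtypeEquiv fun _ => Iff.rfl
  rw [Nat.card_congr e, Module.natCard_eq_pow_finrank (K := K), Nat.card_eq_fintype_card, hK,
    pow_mul]

omit [DecidableEq K] [DecidableEq F] in
theorem forall_commPhase_eq_one_iff (hK : Fintype.card K = Fintype.card F ^ 2) {ω : K}
    (hω : ω ^ Fintype.card F ≠ ω) (C : Submodule K (Fin N → K))
    (w : (Fin N → F) × (Fin N → F)) :
    (∀ u ∈ pairSubgroup ω C, commPhase w u = 1) ↔ pairToExt ω N w ∈ hermDual F C := by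
  constructor
  · intro h
    have hfix : ∀ x ∈ C, hermInner F x (pairToExt ω N w) ^ Fintype.card F =
        hermInner F x (pairToExt ω N w) := by
      intro x hx
      obtain ⟨u, rfl⟩ := (pairToExt_bijective hK hω).2 x
      -- Trivial phases only say that a character is 1 at this value; scaling `u` by all `t : F`
      -- forces the value itself to vanish.
      have h0 : w.2 ⬝ᵥ u.1 - u.2 ⬝ᵥ w.1 = 0 := by
        by_contra h0
        obtain ⟨t, ht⟩ := exists_errChar_mul_ne_one h0
        refine ht ?_
        have hu : t • u ∈ pairSubgroup ω C := by
          rw [mem_pairSubgroup, map_smul, ← algebraMap_smul K]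
          exact C.smul_mem _ hx
        have := h _ hu
        rw [commPhase, Prod.smul_fst, Prod.smul_snd, dotProduct_smul, smul_dotProduct,
          ← smul_sub, smul_eq_mul, mul_comm] at this
        exact this
      have := hermInner_pairToExt_pow_sub hK ω u w
      rw [h0, map_zero, mul_zero] at this
      exact (sub_eq_zero.mp this).symm
    intro x hx
    -- Inner products with codewords are Frobenius-fixed; closure of `C` under scaling by `K` then
    -- makes them zero.
    refine eq_zero_of_forall_mul_pow_card_base_eq hK fun γ => ?_
    rw [← hermInner_smul_left]
    exact hfix _ (C.smul_mem γ hx)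
  · intro h u hu
    have := hermInner_pairToExt_pow_sub hK ω u w
    rw [h _ (mem_pairSubgroup.mp hu), zero_pow Fintype.card_ne_zero, sub_zero] at this
    have := (mul_eq_zero.mp this.symm).resolve_left (sub_ne_zero.mpr hω)
    rw [commPhase, (map_eq_zero _).mp this, AddChar.map_zero_eq_one]

/-- A Hermitian self-orthogonal code of length `N` and dimension `k` gives a stabilizer code of
dimension `q ^ (N - 2 k)`, whose minimum distance is the least weight of a vector of the dual that
is not in the code, or of a nonzero vector if the code is self-dual. -/
theorem exists_stabilizerCode_of_le_hermDual (hK : Fintype.card K = Fintype.card F ^ 2)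
    (hN : 0 < N) {κ : ℕ} (C : Submodule K (Fin N → K)) (hC : C ≤ hermDual F C)
    (hκ : κ + 2 * Module.finrank K C = N) :
    ∃ (d : ℕ) (Q : Submodule ℂ (QuditSpace F N)), IsStabilizerCodeWithParams Q κ d ∧
      (0 < κ → IsLeast {m | ∃ x ∈ hermDual F C, x ∉ C ∧ m = hammingNorm x} d) ∧
      (κ = 0 → IsLeast {m | ∃ x ∈ C, x ≠ 0 ∧ m = hammingNorm x} d) := by
  obtain ⟨ω, hω⟩ := exists_pow_card_base_ne (F := F) hK
  have hbij := pairToExt_bijective (n := N) hK hω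
  have hdual := forall_commPhase_eq_one_iff hK hω C
  obtain ⟨c, hc⟩ := exists_isPhaseLift (pairSubgroup ω C) fun u hu =>
    (hdual u).mpr (hC hu)
  have hfin : Module.finrank ℂ (stabCode (pairSubgroup ω C) c) = Fintype.card F ^ κ := by
    refine Nat.eq_of_mul_eq_mul_left (pow_pos (Fintype.card_pos (α := F)) (2 * Module.finrank K C)) ?_
    rw [← pow_add, add_comm _ κ, hκ, ← hc.card_mul_finrank, card_pairSubgroup hK hω]
  have hdim := finrank_add_finrank_hermDual hK C
  rcases Nat.eq_zero_or_pos κ with h0 | h0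
  · have hCeq : C = hermDual F C := Submodule.eq_of_le_of_finrank_eq hC (by omega)
    have hne : {m | ∃ x ∈ C, x ≠ 0 ∧ m = hammingNorm x}.Nonempty := by
      have : C ≠ ⊥ := fun h => by
        rw [h, finrank_bot] at hκ
        omega
      obtain ⟨x, hx, hx0⟩ := Submodule.exists_mem_ne_zero_of_ne_bot this
      exact ⟨_, x, hx, hx0, rfl⟩
    have hleast : IsLeast _ _ := ⟨Nat.sInf_mem hne, fun m hm => Nat.sInf_le hm⟩
    refine ⟨_, stabCode (pairSubgroup ω C) c, ⟨hc.isStabilizerCode, hfin, ?_⟩,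
      fun h => by omega, fun _ => hleast⟩
    refine hc.hasMinDistance_of_finrank_eq_one (by rw [hfin, h0, pow_zero])
      (fun w hw => by rw [mem_pairSubgroup, hCeq]; exact (hdual w).mp hw) ?_
    have hset : {m | ∃ w, w ∈ pairSubgroup ω C ∧ w ≠ 0 ∧ m = (errSupport w).card} =
        {m | ∃ x ∈ C, x ≠ 0 ∧ m = hammingNorm x} := Set.ext fun m => by
      refine Iff.trans (exists_congr fun w => ?_) hbij.2.exists.symm
      rw [hammingNorm_pairToExt hω, mem_pairSubgroup, ne_eq, ne_eq, map_eq_zero_iff _ hbij.1]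
    rwa [hset]
  · have hne : {m | ∃ x ∈ hermDual F C, x ∉ C ∧ m = hammingNorm x}.Nonempty := by
      have : ¬ hermDual F C ≤ C := fun h => by
        have := Submodule.finrank_mono h
        omega
      obtain ⟨x, hx, hxC⟩ := SetLike.not_le_iff_exists.mp this
      exact ⟨_, x, hx, hxC, rfl⟩
    have hleast : IsLeast _ _ := ⟨Nat.sInf_mem hne, fun m hm => Nat.sInf_le hm⟩
    refine ⟨_, stabCode (pairSubgroup ω C) c, ⟨hc.isStabilizerCode, hfin, ?_⟩,
      fun _ => hleast, fun h => by omega⟩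
    refine hc.hasMinDistance ?_ ?_
    · rw [hfin]
      exact (Nat.one_lt_pow h0.ne' Fintype.one_lt_card).ne'
    · have hset : {m | ∃ w, w ∉ pairSubgroup ω C ∧
            (∀ u ∈ pairSubgroup ω C, commPhase w u = 1) ∧ m = (errSupport w).card} =
          {m | ∃ x ∈ hermDual F C, x ∉ C ∧ m = hammingNorm x} := Set.ext fun m => by
        refine Iff.trans (exists_congr fun w => ?_) hbij.2.exists.symm
        rw [hdual, hammingNorm_pairToExt hω, and_left_comm]
        rfl
      rwa [hset]

end HermitianStabilizer

/-! ### Diagonalization of Hermitian forms -/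

section HermitianForm

variable {F : Type*} [Field F] [Fintype F] {K : Type*} [Field K] [Fintype K] [Algebra F K]
  {V : Type*} [AddCommGroup V] [Module K V]

theorem exists_apply_self_eq_neg_one (hK : Fintype.card K = Fintype.card F ^ 2)
    {h : V → Module.Dual K V} (hsymm : ∀ x y, h y x = h x y ^ Fintype.card F)
    (hne : ∃ x y, h y x ≠ 0) : ∃ v, h v v = -1 := by
  have hadd (x y z : V) : h (x + y) z = h x z + h y z := by
    rw [hsymm z, map_add, add_pow_card_base, ← hsymm, ← hsymm]
  obtain ⟨w, hw⟩ : ∃ w, h w w ≠ 0 := by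
    -- Polarization: if all `h w w` vanish, expanding at `γ • x + y` gives `(γ h y x)^q = -γ h y x`
    -- for every `γ`, so `h = 0`, also in characteristic 2.
    by_contra! h0
    obtain ⟨x, y, hxy⟩ := hne
    refine hxy (eq_zero_of_forall_mul_pow_card_base_eq_neg (F := F) hK fun γ => ?_)
    have := h0 (γ • x + y)
    rw [hadd, map_add, map_add, h0, h0, zero_add, add_zero] at this
    rw [← smul_eq_mul, ← map_smul, ← hsymm]
    exact eq_neg_of_add_eq_zero_left this
  -- The scaling factor needed is Frobenius-fixed, hence a norm.
  have ht : (-(h w w)⁻¹) ^ Fintype.card F = -(h w w)⁻¹ := by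
    rw [neg_pow_card_base, inv_pow, ← hsymm]
  obtain ⟨γ, hγ⟩ := exists_mul_pow_card_base_eq hK ht
  refine ⟨γ • w, ?_⟩
  rw [map_smul, hsymm, map_smul, smul_eq_mul, smul_eq_mul, mul_pow, ← hsymm, ← mul_assoc, hγ,
    neg_mul, inv_mul_cancel₀ hw]

/-- A Hermitian form over a finite field whose radical has codimension at most `e` is minus the
pullback of the standard Hermitian form of rank `e`. -/
theorem exists_hermitian_diagonalization [FiniteDimensional K V]
    (hK : Fintype.card K = Fintype.card F ^ 2) (e : ℕ) (h : V → Module.Dual K V)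
    (hsymm : ∀ x y, h y x = h x y ^ Fintype.card F)
    (he : Module.finrank K V ≤ e + Module.finrank K ↥(⨅ y, LinearMap.ker (h y))) :
    ∃ φ : V →ₗ[K] Fin e → K, ∀ x y, h y x = -hermInner F (φ x) (φ y) := by
  induction e generalizing h with
  | zero =>
    have htop : (⨅ y, LinearMap.ker (h y)) = ⊤ :=
      Submodule.eq_top_of_finrank_eq (le_antisymm (Submodule.finrank_le _) (by omega))
    refine ⟨0, fun x y => ?_⟩
    have hx : x ∈ ⨅ y, LinearMap.ker (h y) := htop ▸ Submodule.mem_top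
    rw [Submodule.mem_iInf] at hx
    simpa [hermInner] using hx y
  | succ e ih =>
    by_cases hne : ∃ x y, h y x ≠ 0
    · obtain ⟨v, hv⟩ := exists_apply_self_eq_neg_one hK hsymm hne
      -- Because `h v v = -1`, this correction puts `v` into the radical while keeping the old
      -- radical, so its codimension drops. The functional `h v` becomes the new coordinate of `φ`.
      obtain ⟨φ, hφ⟩ := ih (fun y => h y + h v y ^ Fintype.card F • h v) (fun x y => by
        simp only [LinearMap.add_apply, LinearMap.smul_apply, smul_eq_mul, add_pow_card_base,
          mul_pow, ← hsymm]
        rw [mul_comm]) (by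
        have hlt : (⨅ y, LinearMap.ker (h y)) <
            ⨅ y, LinearMap.ker (h y + h v y ^ Fintype.card F • h v) := by
          refine SetLike.lt_iff_le_and_exists.mpr ⟨fun x hx => ?_, v, ?_, fun hx => ?_⟩
          · simp only [Submodule.mem_iInf, LinearMap.mem_ker] at hx ⊢
            simp [hx]
          · simp only [Submodule.mem_iInf, LinearMap.mem_ker]
            intro y
            simp [hv, hsymm v y]
          · simp only [Submodule.mem_iInf, LinearMap.mem_ker] at hx
            simpa [hv] using hx v
        have := Submodule.finrank_lt_finrank_of_lt hlt
        omega)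
      refine ⟨LinearMap.pi (Fin.cons (h v) fun i => LinearMap.proj i ∘ₗ φ), fun x y => ?_⟩
      have := hφ x y
      simp only [hermInner, LinearMap.add_apply, LinearMap.smul_apply, smul_eq_mul] at this
      simp only [hermInner, Fin.sum_univ_succ, LinearMap.pi_apply, Fin.cons_zero, Fin.cons_succ,
        LinearMap.comp_apply, LinearMap.proj_apply]
      linear_combination this
    · push Not at hne
      exact ⟨0, fun x y => by simp [hermInner, hne]⟩

end HermitianForm

/-! ### Self-orthogonal extension of a code -/

section Extension

variable {F : Type*} [Field F] [Fintype F] {K : Type*} [Field K] [Fintype K] [Algebra F K]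
  {n e : ℕ}

omit [Fintype K] [Field F] [Algebra F K] in
theorem hermInner_append (a c : Fin n → K) (b d : Fin e → K) :
    hermInner F (Fin.append a b) (Fin.append c d) = hermInner F a c + hermInner F b d := by
  simp [hermInner, Fin.sum_univ_add]

theorem hammingNorm_append {K : Type*} [Zero K] [DecidableEq K] (a : Fin n → K) (b : Fin e → K) :
    hammingNorm (Fin.append a b) = hammingNorm a + hammingNorm b := by
  simp only [hammingNorm, Finset.card_filter, Fin.sum_univ_add, Fin.append_left, Fin.append_right]

theorem exists_eq_append {K : Type*} (x : Fin (n + e) → K) :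
    ∃ (b : Fin n → K) (y : Fin e → K), x = Fin.append b y :=
  ⟨_, _, Fin.append_castAdd_natAdd.symm⟩

theorem append_eq_zero {K : Type*} [Zero K] {b : Fin n → K} {y : Fin e → K} :
    Fin.append b y = 0 ↔ b = 0 ∧ y = 0 := by
  simp [funext_iff, Fin.forall_fin_add]

/-- The code `{(c, φ c) | c ∈ C}`. -/
def graphCode (C : Submodule K (Fin n → K)) (φ : C →ₗ[K] Fin e → K) :
    Submodule K (Fin (n + e) → K) :=
  LinearMap.range (LinearMap.pi (Fin.addCases (fun i => LinearMap.proj i ∘ₗ C.subtype)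
    fun j => LinearMap.proj j ∘ₗ φ) : C →ₗ[K] Fin (n + e) → K)

omit [Fintype K] in
theorem append_mem_graphCode {C : Submodule K (Fin n → K)} {φ : C →ₗ[K] Fin e → K}
    {b : Fin n → K} {y : Fin e → K} :
    Fin.append b y ∈ graphCode C φ ↔ ∃ c : C, (c : Fin n → K) = b ∧ φ c = y := by
  simp [graphCode, LinearMap.mem_range, funext_iff, Fin.forall_fin_add]

omit [Fintype K] in
theorem finrank_graphCode (C : Submodule K (Fin n → K)) (φ : C →ₗ[K] Fin e → K) :
    Module.finrank K (graphCode C φ) = Module.finrank K C := by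
  refine LinearMap.finrank_range_of_inj fun c c' h => Subtype.ext (funext fun i => ?_)
  simpa using congrFun h (Fin.castAdd e i)

omit [Fintype K] in
theorem append_mem_hermDual_graphCode {C : Submodule K (Fin n → K)} {φ : C →ₗ[K] Fin e → K}
    {b : Fin n → K} {y : Fin e → K} :
    Fin.append b y ∈ hermDual F (graphCode C φ) ↔
      ∀ c : C, hermInner F (c : Fin n → K) b + hermInner F (φ c) y = 0 := by
  rw [mem_hermDual]
  constructor
  · intro h c
    rw [← hermInner_append]
    exact h _ (append_mem_graphCode.mpr ⟨c, rfl, rfl⟩)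
  · intro h x hx
    obtain ⟨b', y', rfl⟩ := exists_eq_append x
    obtain ⟨c, rfl, rfl⟩ := append_mem_graphCode.mp hx
    rw [hermInner_append]
    exact h c

/-- A code whose Hermitian hull has codimension `e` is extended by `e` coordinates to a
Hermitian self-orthogonal code. -/
theorem exists_selfOrthogonal_extension (hK : Fintype.card K = Fintype.card F ^ 2)
    (C : Submodule K (Fin n → K))
    (he : e + Module.finrank K ↥(C ⊓ hermDual F C) = Module.finrank K C) :
    ∃ φ : C →ₗ[K] Fin e → K, Function.Surjective φ ∧
      (∀ c : C, φ c = 0 ↔ (c : Fin n → K) ∈ hermDual F C) ∧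
      graphCode C φ ≤ hermDual F (graphCode C φ) := by
  let h : C → Module.Dual K C := fun y => (hermFunctional F (y : Fin n → K)).domRestrict C
  have happ (x y : C) : h y x = hermInner F (x : Fin n → K) y := rfl
  have hrad : (⨅ y, LinearMap.ker (h y)) = (C ⊓ hermDual F C).comap C.subtype := by
    ext x
    simp only [Submodule.mem_iInf, LinearMap.mem_ker, happ, Submodule.mem_comap,
      Submodule.subtype_apply, Submodule.mem_inf, x.2, true_and, mem_hermDual, Subtype.forall]
    refine forall₂_congr fun y _ => ?_
    rw [← hermInner_pow hK, pow_eq_zero_iff Fintype.card_ne_zero]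
  have hfin : Module.finrank K ↥(⨅ y, LinearMap.ker (h y)) =
      Module.finrank K ↥(C ⊓ hermDual F C) := by
    rw [hrad]
    exact (Submodule.comapSubtypeEquivOfLe inf_le_left).finrank_eq
  obtain ⟨φ, hφ⟩ := exists_hermitian_diagonalization hK e h
    (fun x y => (hermInner_pow hK _ _).symm) (by omega)
  have hker : LinearMap.ker φ ≤ ⨅ y, LinearMap.ker (h y) := fun x hx => by
    simp only [Submodule.mem_iInf, LinearMap.mem_ker] at hx ⊢
    intro y
    rw [hφ, hx]
    simp [hermInner]
  -- The kernel lies in the radical, of codimension `e`, and the range has dimension at most `e`;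
  -- rank-nullity turns both into equalities.
  have hrank := LinearMap.finrank_range_add_finrank_ker φ
  have hle := Submodule.finrank_mono hker
  have hrange := Submodule.finrank_le (LinearMap.range φ)
  rw [Module.finrank_fin_fun] at hrange
  have hkereq := Submodule.eq_of_le_of_finrank_eq hker (by omega)
  refine ⟨φ, LinearMap.range_eq_top.mp (Submodule.eq_top_of_finrank_eq
    (by rw [Module.finrank_fin_fun]; omega)), fun c => ?_, fun x hx => ?_⟩
  · rw [← LinearMap.mem_ker, hkereq, hrad, Submodule.mem_comap, Submodule.mem_inf]
    exact and_iff_right c.2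
  · obtain ⟨b, y, rfl⟩ := exists_eq_append x
    obtain ⟨c, rfl, rfl⟩ := append_mem_graphCode.mp hx
    rw [append_mem_hermDual_graphCode]
    intro c'
    rw [← happ, hφ, neg_add_cancel]

omit [Fintype K] in
theorem append_zero_mem_hermDual_graphCode {C : Submodule K (Fin n → K)}
    {φ : C →ₗ[K] Fin e → K} {b : Fin n → K} :
    Fin.append b 0 ∈ hermDual F (graphCode C φ) ↔ b ∈ hermDual F C := by
  rw [append_mem_hermDual_graphCode, mem_hermDual]
  simp [hermInner, Fintype.card_ne_zero]

omit [Fintype K] in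
/-- A vector of the dual of the extended code is a codeword plus a vector of `C^⊥` padded by
zeros. -/
theorem exists_add_of_append_mem_hermDual_graphCode {C : Submodule K (Fin n → K)}
    {φ : C →ₗ[K] Fin e → K} (hφ : Function.Surjective φ)
    (hC : graphCode C φ ≤ hermDual F (graphCode C φ)) {b : Fin n → K} {y : Fin e → K}
    (h : Fin.append b y ∈ hermDual F (graphCode C φ)) :
    ∃ c : C, φ c = y ∧ b - c ∈ hermDual F C := by
  obtain ⟨c, rfl⟩ := hφ y
  refine ⟨c, rfl, ?_⟩
  rw [← append_zero_mem_hermDual_graphCode (φ := φ)]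
  have := Submodule.sub_mem _ h (hC (append_mem_graphCode.mpr ⟨c, rfl, rfl⟩))
  convert this using 1
  refine funext fun i => ?_
  refine Fin.addCases (fun i => ?_) (fun i => ?_) i <;> simp

omit [Fintype K] in
-- With `φ c = y` and `b - c` in both `C` and its dual, `b - c` lies in the kernel of `φ`, so `φ b =
-- y`.
theorem append_mem_graphCode_of_mem {C : Submodule K (Fin n → K)}
    {φ : C →ₗ[K] Fin e → K} (hφ : Function.Surjective φ)
    (hφ0 : ∀ c : C, φ c = 0 ↔ (c : Fin n → K) ∈ hermDual F C)
    (hC : graphCode C φ ≤ hermDual F (graphCode C φ)) {b : Fin n → K} {y : Fin e → K}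
    (h : Fin.append b y ∈ hermDual F (graphCode C φ)) (hb : b ∈ C) :
    Fin.append b y ∈ graphCode C φ := by
  obtain ⟨c, rfl, hc⟩ := exists_add_of_append_mem_hermDual_graphCode hφ hC h
  refine append_mem_graphCode.mpr ⟨⟨b, hb⟩, rfl, ?_⟩
  rw [← sub_eq_zero, ← map_sub, hφ0]
  exact hc

end Extension

/-! ### Minimum weight and minimum distance -/

section Weights

variable {K : Type*} [Field K] [DecidableEq K] {n : ℕ}

theorem minWeight_le_hammingNorm {S : Set (Fin n → K)} {x : Fin n → K} (hx : x ∈ S)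
    (h0 : x ≠ 0) : minWeight S ≤ hammingNorm x := by
  rw [minWeight, if_pos ⟨x, hx, h0⟩]
  exact Nat.sInf_le ⟨x, ⟨hx, h0⟩, rfl⟩

theorem exists_hammingNorm_eq_minWeight {S : Set (Fin n → K)} (hS : (S \ {0}).Nonempty) :
    ∃ x ∈ S, hammingNorm x = minWeight S := by
  rw [minWeight, if_pos hS]
  obtain ⟨x, hx, h⟩ := Nat.sInf_mem (s := {w | ∃ x ∈ S \ {0}, w = hammingNorm x})
    (let ⟨x, hx⟩ := hS; ⟨_, x, hx, rfl⟩)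
  exact ⟨x, hx.1, h.symm⟩

theorem minDist_le_hammingNorm {S : Set (Fin n → K)} (hS : 0 ∈ S) {x : Fin n → K} (hx : x ∈ S)
    (h0 : x ≠ 0) : minDist S ≤ hammingNorm x := by
  rw [minDist, if_pos ⟨x, hx, 0, hS, h0⟩]
  exact Nat.sInf_le ⟨x, hx, 0, hS, h0, (hammingDist_zero_right x).symm⟩

omit [Field K] in
theorem minDist_le (S : Set (Fin n → K)) : minDist S ≤ n := by
  rw [minDist]
  split_ifs with h
  · obtain ⟨x, hx, y, hy, hxy⟩ := h
    refine (Nat.sInf_le (s := {w | ∃ x ∈ S, ∃ y ∈ S, x ≠ y ∧ w = hammingDist x y})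
      ⟨x, hx, y, hy, hxy, rfl⟩).trans ?_
    simpa using hammingDist_le_card_fintype (x := x) (y := y)
  · exact le_rfl

theorem minDist_le_minWeight {S T : Set (Fin n → K)} (hS : 0 ∈ S) (hTS : T ⊆ S) :
    minDist S ≤ minWeight T := by
  by_cases hT : (T \ {0}).Nonempty
  · rw [minWeight, if_pos hT]
    refine le_csInf (let ⟨x, hx⟩ := hT; ⟨_, x, hx, rfl⟩) ?_
    rintro _ ⟨x, hx, rfl⟩
    exact minDist_le_hammingNorm hS (hTS hx.1) hx.2
  -- The default value `n` bounds every minimum distance in length `n`.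
  · rw [minWeight, if_neg hT]
    exact minDist_le S

end Weights

/-! ### Parameters and distance bounds of the resulting quantum code -/

theorem mainTheorem1 {F K : Type*} [Field F] [Fintype F] [DecidableEq F]
    [Field K] [Fintype K] [DecidableEq K] [Algebra F K]
    (q : ℕ) (hF : Fintype.card F = q) (hK : Fintype.card K = q ^ 2)
    (n k e : ℕ) (hn : 0 < n) (C : Submodule K (Fin n → K))
    (hk : Module.finrank K C = k)
    (he : e + Module.finrank K ↥(C ⊓ hermDual F C) = k) :
    ∃ (κ d : ℕ) (Q : Submodule ℂ (QuditSpace F (n + e))),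
      κ + 2 * k = n + e ∧
      IsStabilizerCodeWithParams Q κ d ∧
      (0 < κ →
        min (minWeight ((hermDual F C : Set (Fin n → K)) \ ↑(C ⊓ hermDual F C)))
            (minWeight ((↑(C ⊔ hermDual F C) : Set (Fin n → K)) \ ↑C) + 1) ≤ d ∧
        d ≤ minWeight ((hermDual F C : Set (Fin n → K)) \ ↑(C ⊓ hermDual F C))) ∧
      min (minDist (hermDual F C : Set (Fin n → K)))
          (minDist (↑(C ⊔ hermDual F C) : Set (Fin n → K)) + 1) ≤
        min (minWeight ((hermDual F C : Set (Fin n → K)) \ ↑(C ⊓ hermDual F C)))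
            (minWeight ((↑(C ⊔ hermDual F C) : Set (Fin n → K)) \ ↑C) + 1) ∧
      min (minDist (hermDual F C : Set (Fin n → K)))
          (minDist (↑(C ⊔ hermDual F C) : Set (Fin n → K)) + 1) ≤ d := by
  subst hF
  have hdim := finrank_add_finrank_hermDual hK C
  have hhull : Module.finrank K ↥(C ⊓ hermDual F C) ≤ Module.finrank K (hermDual F C) :=
    Submodule.finrank_mono inf_le_right
  -- The hull has dimension `k - e` and sits in the dual, of dimension `n - k`; hence `2k ≤ n + e`.
  obtain ⟨κ, hκ⟩ : ∃ κ, κ + 2 * k = n + e := ⟨n + e - 2 * k, by omega⟩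
  obtain ⟨φ, hφ, hφ0, hself⟩ := exists_selfOrthogonal_extension (F := F) (e := e) hK C (by omega)
  obtain ⟨d, Q, hQ, hpos, hzero⟩ := exists_stabilizerCode_of_le_hermDual hK (by omega)
    (graphCode C φ) hself (by rw [finrank_graphCode, hk, hκ])
  have hcompare : min (minDist (hermDual F C : Set (Fin n → K)))
      (minDist (↑(C ⊔ hermDual F C) : Set (Fin n → K)) + 1) ≤
      min (minWeight ((hermDual F C : Set (Fin n → K)) \ ↑(C ⊓ hermDual F C)))
        (minWeight ((↑(C ⊔ hermDual F C) : Set (Fin n → K)) \ ↑C) + 1) :=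
    min_le_min (minDist_le_minWeight (Submodule.zero_mem _) Set.sdiff_subset)
      (Nat.succ_le_succ (minDist_le_minWeight (Submodule.zero_mem _) Set.sdiff_subset))
  have hlower : 0 < κ → min (minWeight ((hermDual F C : Set (Fin n → K)) \ ↑(C ⊓ hermDual F C)))
      (minWeight ((↑(C ⊔ hermDual F C) : Set (Fin n → K)) \ ↑C) + 1) ≤ d := by
    intro h
    obtain ⟨⟨x, hx, hxC, rfl⟩, -⟩ := hpos h
    obtain ⟨b, y, rfl⟩ := exists_eq_append x
    rw [hammingNorm_append]
    have hbC : b ∉ C := fun hb => hxC (append_mem_graphCode_of_mem hφ hφ0 hself hx hb)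
    have hb0 : b ≠ 0 := fun hb => hbC (hb ▸ C.zero_mem)
    by_cases hy : y = 0
    · subst hy
      have hb : b ∈ (hermDual F C : Set (Fin n → K)) \ ↑(C ⊓ hermDual F C) :=
        ⟨append_zero_mem_hermDual_graphCode.mp hx, fun hb => hbC hb.1⟩
      exact (min_le_left _ _).trans ((minWeight_le_hammingNorm hb hb0).trans
        (Nat.le_add_right _ _))
    · obtain ⟨c, -, hc⟩ := exists_add_of_append_mem_hermDual_graphCode hφ hself hx
      have hb : b ∈ (↑(C ⊔ hermDual F C) : Set (Fin n → K)) \ ↑C :=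
        ⟨Submodule.mem_sup.mpr ⟨c, c.2, b - c, hc, by abel⟩, hbC⟩
      exact (min_le_right _ _).trans (add_le_add (minWeight_le_hammingNorm hb hb0)
        (hammingNorm_pos_iff.mpr hy))
  refine ⟨κ, d, Q, hκ, hQ, fun h => ⟨hlower h, ?_⟩, hcompare, ?_⟩
  -- For `κ > 0` the dual is strictly larger than the hull, so the weight is attained rather than
  -- the default `n`; padding a minimizer by zeros gives the upper bound.
  · have hne : (((hermDual F C : Set (Fin n → K)) \ ↑(C ⊓ hermDual F C)) \ {0}).Nonempty := by
      have : ¬ hermDual F C ≤ C ⊓ hermDual F C := fun hle => by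
        have := Submodule.finrank_mono hle
        omega
      obtain ⟨b, hb, hbC⟩ := SetLike.not_le_iff_exists.mp this
      exact ⟨b, ⟨hb, hbC⟩, fun h0 => hbC ((show b = 0 from h0) ▸ Submodule.zero_mem _)⟩
    obtain ⟨b, ⟨hb, hbC⟩, hbw⟩ := exists_hammingNorm_eq_minWeight hne
    rw [← hbw]
    refine (hpos h).2 ⟨Fin.append b 0, append_zero_mem_hermDual_graphCode.mpr hb, fun hmem => ?_,
      by rw [hammingNorm_append, hammingNorm_zero, add_zero]⟩
    obtain ⟨c, rfl, -⟩ := append_mem_graphCode.mp hmem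
    exact hbC ⟨c.2, hb⟩
  · rcases Nat.eq_zero_or_pos κ with h | h
    -- In the self-dual case the competing vectors are `(c, φ c)` with `c ≠ 0`: either `c ∈ C^⊥`, or
    -- `φ c` adds at least 1 to the weight.
    · obtain ⟨⟨x, hx, hx0, rfl⟩, -⟩ := hzero h
      obtain ⟨b, y, rfl⟩ := exists_eq_append x
      rw [hammingNorm_append]
      obtain ⟨c, rfl, rfl⟩ := append_mem_graphCode.mp hx
      have hc0 : (c : Fin n → K) ≠ 0 := fun h0 => hx0 (append_eq_zero.mpr
        ⟨h0, by rw [Subtype.ext h0 (a2 := (0 : C)), map_zero]⟩)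
      by_cases hy : φ c = 0
      · exact (min_le_left _ _).trans ((minDist_le_hammingNorm (Submodule.zero_mem _)
          ((hφ0 c).mp hy) hc0).trans (Nat.le_add_right _ _))
      · exact (min_le_right _ _).trans (add_le_add (minDist_le_hammingNorm
          (Submodule.zero_mem _) (Submodule.mem_sup_left c.2) hc0) (hammingNorm_pos_iff.mpr hy))
    · exact hcompare.trans (hlower h)

end
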